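/- Let $b\in\{1,-1\}$, let $m\ge 1$ be an integer coprime to $10$, let $q=5^m$, and let $K$ be an algebraic closure of $\mathbb{F}_q$. Let $C$ be the smooth projective curve of genus $2$ over $\mathbb{F}_q$ with affine equation $y^2=x^5-x+b$ (it has exactly one point at infinity), let $\mathrm{Jac}(C)$ be its Jacobian, and identify $\mathrm{Jac}(C)(K)$ with the group of divisor classes of degree $0$ on $C$ over $K$. Let $\pi$ be the endomorphism of $\mathrm{Jac}(C)(K)$ induced by the $q$-power Frobenius map $(x,y)\mapsto(x^q,y^q)$ on points, so that $\mathrm{Jac}(C)(\mathbb{F}_{q^n})=\{D\in\mathrm{Jac}(C)(K):\pi^n(D)=D\}$ for $n\ge1$. The trace is the homomorphism $$\mathrm{Tr}:\mathrm{Jac}(C)(\mathbb{F}_{q^n})\to\mathrm{Jac}(C)(\mathbb{F}_q),\qquad \mathrm{Tr}(D)=\sum_{i=0}^{n-1}\pi^i(D),$$ and its kernel is the trace-zero subgroup of $\mathrm{Jac}(C)(\mathbb{F}_{q^n})$. Let $\rho\in\mathbb{F}_{5^5}\subset K$ satisfy $\rho^5-\rho+2b=0$, and let $\psi$ be the endomorphism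 of $\mathrm{Jac}(C)$ induced by the automorphism $(x,y)\mapsto(\rho-x,\,2y)$ of $C$. If $D\in\mathrm{Jac}(C)(\mathbb{F}_q)$, then $\psi(D)$ lies in $\mathrm{Jac}(C)(\mathbb{F}_{q^5})$ and $\mathrm{Tr}(\psi(D))=\sum_{i=0}^{4}\pi^i(\psi(D))=0$; that is, $\psi(D)$ lies in the trace-zero subgroup of $\mathrm{Jac}(C)(\mathbb{F}_{q^5})$. -/

import Mathlib

noncomputable section

open Polynomial WithZero

namespace QuinticCurve

/-- The polynomial `x ^ 5 - x + b` over `K`. -/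
def quintic (K : Type*) [Field K] (b : ℤ) : K[X] := X ^ 5 - X + C (b : K)

/-- The affine coordinate ring `K[x, y] / (y ^ 2 - (x ^ 5 - x + b))`; its elements are written
`u + v y` with `u = re` and `v = im` in `K[x]`. -/
abbrev CoordRing (K : Type*) [Field K] (b : ℤ) : Type _ :=
  QuadraticAlgebra K[X] (quintic K b) 0

/-- The function field of the curve. -/
abbrev FunField (K : Type*) [Field K] (b : ℤ) : Type _ := FractionRing (CoordRing K b)

section Basic

variable {K : Type*} [Field K] {b : ℤ}

lemma degree_quintic : (quintic K b).degree = 5 := by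
  unfold quintic; compute_degree!

lemma quintic_ne_zero : quintic K b ≠ 0 := by
  intro h
  have := degree_quintic (K := K) (b := b)
  simp [h] at this

lemma norm_eq (r : CoordRing K b) :
    QuadraticAlgebra.norm r = r.re ^ 2 - quintic K b * r.im ^ 2 := by
  rw [QuadraticAlgebra.norm_def]; ring

lemma degree_norm (r : CoordRing K b) :
    (QuadraticAlgebra.norm r).degree = max (r.re ^ 2).degree (quintic K b * r.im ^ 2).degree := by
  rw [norm_eq]
  by_cases hu : r.re = 0
  · simp [hu]
  by_cases hv : r.im = 0
  · simp [hv]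
  have h : (r.re ^ 2).degree ≠ (quintic K b * r.im ^ 2).degree := by
    rw [degree_mul, degree_pow, degree_pow, degree_quintic, degree_eq_natDegree hu,
      degree_eq_natDegree hv]
    intro h
    have h2 : 2 * r.re.natDegree = 5 + 2 * r.im.natDegree := by
      have : ((2 * r.re.natDegree : ℕ) : WithBot ℕ) = ((5 + 2 * r.im.natDegree : ℕ) : WithBot ℕ) := by
        push_cast; simpa using h
      exact_mod_cast this
    omega
  rw [sub_eq_add_neg]
  rw [← degree_neg (quintic K b * r.im ^ 2)] at h ⊢
  rcases lt_or_gt_of_ne h with h | h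
  · rw [degree_add_eq_right_of_degree_lt h, max_eq_right h.le]
  · rw [degree_add_eq_left_of_degree_lt h, max_eq_left h.le]

lemma norm_eq_zero {r : CoordRing K b} : QuadraticAlgebra.norm r = 0 ↔ r = 0 := by
  constructor
  · intro h
    have h1 := degree_norm r
    rw [h, degree_zero, eq_comm, max_eq_bot, degree_eq_bot, degree_eq_bot] at h1
    have h2 := h1.2
    rw [mul_eq_zero, or_iff_right quintic_ne_zero] at h2
    exact QuadraticAlgebra.ext (pow_eq_zero_iff two_ne_zero |>.1 h1.1)
      (pow_eq_zero_iff two_ne_zero |>.1 h2)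
  · rintro rfl; simp

instance : NoZeroDivisors (CoordRing K b) where
  eq_zero_or_eq_zero_of_mul_eq_zero {x y} h := by
    rw [← norm_eq_zero, map_mul, mul_eq_zero, norm_eq_zero, norm_eq_zero] at h
    exact h

instance : IsDomain (CoordRing K b) := NoZeroDivisors.to_isDomain _

instance : IsNoetherianRing (CoordRing K b) := IsNoetherianRing.of_finite K[X] _

instance : Ring.DimensionLEOne (CoordRing K b) := Ring.DimensionLEOne.of_isIntegral K[X] _

lemma dvd_of_sq_dvd {n v f : K[X]} (hf : Squarefree f) (h : n ^ 2 ∣ f * v ^ 2) : n ∣ v := by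
  by_cases hn : n = 0
  · subst hn
    have : f * v ^ 2 = 0 := by simpa using h
    rcases mul_eq_zero.1 this with h0 | h0
    · exact absurd h0 hf.ne_zero
    · simp [pow_eq_zero_iff two_ne_zero |>.1 h0]
  let : GCDMonoid K[X] := UniqueFactorizationMonoid.toGCDMonoid _
  obtain ⟨n', v', h1, h2, hu⟩ := extract_gcd n v
  set d := gcd n v with hd
  have hd0 : d ≠ 0 := by
    intro h0; rw [h0, zero_mul] at h1; exact hn h1
  have hc : IsCoprime (n' ^ 2) (v' ^ 2) := ((gcd_isUnit_iff _ _).1 hu).pow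
  have h3 : n' ^ 2 ∣ f * v' ^ 2 := by
    rw [h1, h2] at h
    have : d ^ 2 * n' ^ 2 ∣ d ^ 2 * (f * v' ^ 2) := by
      convert h using 1 <;> ring
    exact (mul_dvd_mul_iff_left (pow_ne_zero 2 hd0)).1 this
  have h4 : n' * n' ∣ f := by
    rw [← sq]; exact hc.dvd_of_dvd_mul_right h3
  rw [h1, h2]
  exact mul_dvd_mul_left d (hf n' h4).dvd

lemma dvd_of_isIntegral {n p : K[X]} (hn : n ≠ 0)
    (h : IsIntegral K[X] (algebraMap K[X] (FunField K b) p /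
      algebraMap K[X] (FunField K b) n)) : n ∣ p := by
  let := FractionRing.liftAlgebra K[X] (FunField K b)
  rw [IsScalarTower.algebraMap_apply K[X] (FractionRing K[X]) (FunField K b),
    IsScalarTower.algebraMap_apply K[X] (FractionRing K[X]) (FunField K b) n,
    ← map_div₀, isIntegral_algebraMap_iff (FaithfulSMul.algebraMap_injective _ _),
    IsIntegrallyClosed.isIntegral_iff] at h
  obtain ⟨y, hy⟩ := h
  refine ⟨y, ?_⟩
  apply FaithfulSMul.algebraMap_injective K[X] (FractionRing K[X])
  have : algebraMap K[X] (FractionRing K[X]) n ≠ 0 := by simpa using hn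
  rw [map_mul, hy]; field_simp

/-- The hyperelliptic involution `u + v y ↦ u - v y` on the coordinate ring. -/
def conj : CoordRing K b →ₐ[K[X]] CoordRing K b where
  __ := (starRingEnd (CoordRing K b))
  commutes' p := by
    change star (algebraMap K[X] (CoordRing K b) p) = _
    ext <;> simp

lemma conj_apply (r : CoordRing K b) : conj r = ⟨r.re, -r.im⟩ := by
  change star r = _
  ext <;> simp

lemma exists_conj_funField : ∃ σ : FunField K b →ₐ[K[X]] FunField K b,
    ∀ r : CoordRing K b, σ (algebraMap _ (FunField K b) r) =
      algebraMap _ (FunField K b) (conj r) := by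
  have hg : Function.Injective
      ((IsScalarTower.toAlgHom K[X] (CoordRing K b) (FunField K b)).comp conj) := by
    intro r s h
    have h1 : conj r = conj s := IsFractionRing.injective (CoordRing K b) (FunField K b) h
    rw [conj_apply, conj_apply, QuadraticAlgebra.mk.injEq, neg_inj] at h1
    exact QuadraticAlgebra.ext h1.1 h1.2
  exact ⟨IsFractionRing.liftAlgHom hg, fun r => IsFractionRing.lift_algebraMap hg r⟩

end Basic

section Dedekind

variable {K : Type*} [Field K] [CharP K 5] {b : ℤ}

lemma squarefree_quintic : Squarefree (quintic K b) := by
  apply Separable.squarefree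
  have h5 : ((5 : ℕ) : K) = 0 := CharP.cast_eq_zero K 5
  refine ⟨0, -1, ?_⟩
  have : derivative (quintic K b) = -1 := by
    unfold quintic
    simp only [derivative_add, derivative_sub, derivative_X_pow, derivative_X, derivative_C, h5]
    simp
  rw [this]; simp

lemma two_ne_zero_of_char : (2 : K) ≠ 0 := by
  have : ((2 : ℕ) : K) ≠ 0 := by
    rw [Ne, CharP.cast_eq_zero_iff K 5]; decide
  exact_mod_cast this

lemma exists_of_isIntegral (t : CoordRing K b) {n : K[X]} (hn0 : n ≠ 0)
    (hz : IsIntegral K[X] (algebraMap _ (FunField K b) t / algebraMap K[X] (FunField K b) n)) :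
    ∃ q : CoordRing K b, t = q * algebraMap K[X] (CoordRing K b) n := by
  obtain ⟨σ, hσ⟩ := exists_conj_funField (K := K) (b := b)
  have hσz := hz.map σ
  rw [map_div₀, hσ, AlgHom.commutes] at hσz
  have hadd := hz.add hσz
  have hsub := (hz.sub hσz).pow 2
  have e1 : t + conj t = algebraMap K[X] _ (2 * t.re) := by
    rw [conj_apply, QuadraticAlgebra.algebraMap_eq]
    exact QuadraticAlgebra.ext (by simp; ring) (by simp)
  have e2 : (t - conj t) ^ 2 = algebraMap K[X] _ (quintic K b * (2 * t.im) ^ 2) := by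
    rw [conj_apply, sq, QuadraticAlgebra.algebraMap_eq]
    exact QuadraticAlgebra.ext (by simp; ring) (by simp)
  rw [← add_div, ← map_add, e1, ← IsScalarTower.algebraMap_apply] at hadd
  rw [← sub_div, ← map_sub, div_pow, ← map_pow, ← map_pow, e2,
    ← IsScalarTower.algebraMap_apply] at hsub
  have d1 := dvd_of_isIntegral hn0 hadd
  have d2 := dvd_of_sq_dvd squarefree_quintic (dvd_of_isIntegral (pow_ne_zero 2 hn0) hsub)
  have h2u : IsUnit (2 : K[X]) := by
    rw [← C_ofNat]; exact isUnit_C.2 (isUnit_iff_ne_zero.2 two_ne_zero_of_char)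
  obtain ⟨p, hp⟩ := h2u.dvd_mul_left.1 d1
  obtain ⟨v, hv⟩ := h2u.dvd_mul_left.1 d2
  refine ⟨⟨p, v⟩, ?_⟩
  rw [QuadraticAlgebra.algebraMap_eq]
  exact QuadraticAlgebra.ext (by simp [hp, mul_comm]) (by simp [hv, mul_comm])

lemma isIntegrallyClosed : IsIntegrallyClosed (CoordRing K b) := by
  rw [isIntegrallyClosed_iff (FunField K b)]
  intro z hz
  have hz' : IsIntegral K[X] z := isIntegral_trans z hz
  obtain ⟨r, s, hs, rfl⟩ := IsFractionRing.div_surjective (A := CoordRing K b) z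
  have hs0 : s ≠ 0 := nonZeroDivisors.ne_zero hs
  have hn0 : QuadraticAlgebra.norm s ≠ 0 := norm_eq_zero.not.2 hs0
  have hns : algebraMap K[X] (CoordRing K b) (QuadraticAlgebra.norm s) = s * conj s :=
    QuadraticAlgebra.algebraMap_norm_eq_mul_star s
  have hconj0 : conj s ≠ 0 := by
    intro h
    rw [h, mul_zero, QuadraticAlgebra.algebraMap_eq] at hns
    exact hn0 (congrArg QuadraticAlgebra.re hns)
  have h1 : algebraMap _ (FunField K b) s ≠ 0 :=
    (map_ne_zero_iff _ (IsFractionRing.injective _ _)).2 hs0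
  have h2 : algebraMap _ (FunField K b) (conj s) ≠ 0 :=
    (map_ne_zero_iff _ (IsFractionRing.injective _ _)).2 hconj0
  have hz2 : algebraMap _ (FunField K b) r / algebraMap _ (FunField K b) s =
      algebraMap _ (FunField K b) (r * conj s) /
        algebraMap K[X] (FunField K b) (QuadraticAlgebra.norm s) := by
    rw [IsScalarTower.algebraMap_apply K[X] (CoordRing K b) (FunField K b), hns, map_mul, map_mul,
      mul_div_mul_right _ _ h2]
  rw [hz2] at hz'
  obtain ⟨q, hq⟩ := exists_of_isIntegral _ hn0 hz'
  refine ⟨q, ?_⟩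
  rw [eq_div_iff h1, ← map_mul]
  congr 1
  rw [hns, ← mul_assoc] at hq
  exact (mul_right_cancel₀ hconj0 hq).symm

instance : IsDedekindDomain (CoordRing K b) where
  __ := (inferInstance : IsDomain (CoordRing K b))
  __ := (inferInstance : IsNoetherianRing (CoordRing K b))
  __ := (inferInstance : Ring.DimensionLEOne (CoordRing K b))
  __ := (isIntegrallyClosed : IsIntegrallyClosed (CoordRing K b))

end Dedekind

/-- The points of the smooth projective curve with affine model `y ^ 2 = x ^ 5 - x + b`:
the affine solutions over `K`, and a single point at infinity. -/
inductive Point (K : Type*) [Field K] (b : ℤ) : Type _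
  | infinity : Point K b
  | affine (x y : K) (h : y ^ 2 = x ^ 5 - x + (b : K)) : Point K b

section Valuations

variable {K : Type*} [Field K] {b : ℤ}

/-- Evaluation of a regular function at an affine point. -/
def evalAt (x y : K) (h : y ^ 2 = x ^ 5 - x + (b : K)) : CoordRing K b →+* K where
  toFun r := r.re.eval x + r.im.eval x * y
  map_zero' := by simp
  map_one' := by simp [QuadraticAlgebra.re_one, QuadraticAlgebra.im_one]
  map_add' r s := by simp; ring
  map_mul' r s := by
    have hq : (quintic K b).eval x = y ^ 2 := by rw [h]; simp [quintic]
    simp [hq]; ring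

lemma evalAt_apply (x y : K) (h : y ^ 2 = x ^ 5 - x + (b : K)) (r : CoordRing K b) :
    evalAt x y h r = r.re.eval x + r.im.eval x * y := rfl

/-- The maximal ideal of the regular functions that vanish at an affine point. -/
def pointIdeal (x y : K) (h : y ^ 2 = x ^ 5 - x + (b : K)) :
    IsDedekindDomain.HeightOneSpectrum (CoordRing K b) where
  asIdeal := RingHom.ker (evalAt x y h)
  isPrime := RingHom.ker_isPrime _
  ne_bot := by
    intro h0
    have h1 : (⟨X - C x, 0⟩ : CoordRing K b) ∈ RingHom.ker (evalAt x y h) := by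
      rw [RingHom.mem_ker, evalAt_apply]; simp
    rw [h0, Ideal.mem_bot] at h1
    exact X_sub_C_ne_zero x (congrArg QuadraticAlgebra.re h1)

open scoped Classical in
/-- The valuation at the point at infinity on the regular functions: the pole order of
`r = u + v y` there is the degree of its norm `u ^ 2 - (x ^ 5 - x + b) v ^ 2` to `K[x]`,
that is, `max (2 deg u) (2 deg v + 5)`. -/
def inftyIntValuation (K : Type*) [Field K] (b : ℤ) : Valuation (CoordRing K b) ℤᵐ⁰ where
  toFun r := if r = 0 then 0 else exp ((QuadraticAlgebra.norm r).natDegree : ℤ)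
  map_zero' := by simp
  map_one' := by simp
  map_mul' r s := by
    by_cases hr : r = 0
    · simp [hr]
    by_cases hs : s = 0
    · simp [hs]
    rw [if_neg (mul_ne_zero hr hs), if_neg hr, if_neg hs, map_mul,
      natDegree_mul (norm_eq_zero.not.2 hr) (norm_eq_zero.not.2 hs), ← exp_add]
    push_cast; rfl
  map_add_le_max' r s := by
    by_cases hrs : r + s = 0
    · simp [hrs]
    by_cases hr : r = 0
    · simp [hr]
    by_cases hs : s = 0
    · simp [hs]
    rw [if_neg hrs, if_neg hr, if_neg hs]
    have key (u v : K[X]) : ((u + v) ^ 2).degree ≤ max (u ^ 2).degree (v ^ 2).degree := by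
      simp only [degree_pow]
      rcases le_max_iff.1 (degree_add_le u v) with h | h
      · exact le_max_of_le_left (nsmul_le_nsmul_right h 2)
      · exact le_max_of_le_right (nsmul_le_nsmul_right h 2)
    have h : (QuadraticAlgebra.norm (r + s)).degree ≤
        max (QuadraticAlgebra.norm r).degree (QuadraticAlgebra.norm s).degree := by
      simp only [degree_norm, QuadraticAlgebra.re_add, QuadraticAlgebra.im_add]
      refine max_le ((key _ _).trans (max_le_max (le_max_left _ _) (le_max_left _ _))) ?_
      rw [degree_mul]
      rcases le_max_iff.1 (key r.im s.im) with h | h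
      · refine le_max_of_le_left (le_max_of_le_right ?_)
        rw [degree_mul]; gcongr
      · refine le_max_of_le_right (le_max_of_le_right ?_)
        rw [degree_mul]; gcongr
    rcases le_max_iff.1 h with h | h
    · exact le_max_of_le_left (exp_le_exp.2 (by exact_mod_cast natDegree_le_natDegree h))
    · exact le_max_of_le_right (exp_le_exp.2 (by exact_mod_cast natDegree_le_natDegree h))

lemma inftyIntValuation_of_ne_zero {r : CoordRing K b} (hr : r ≠ 0) :
    inftyIntValuation K b r = exp ((QuadraticAlgebra.norm r).natDegree : ℤ) := by
  classical
  exact if_neg hr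

lemma nonZeroDivisors_le_primeCompl :
    nonZeroDivisors (CoordRing K b) ≤ (inftyIntValuation K b).supp.primeCompl := by
  intro r hr h
  have h0 := nonZeroDivisors.ne_zero hr
  rw [SetLike.mem_coe, Valuation.mem_supp_iff, inftyIntValuation_of_ne_zero h0] at h
  exact exp_ne_zero h

/-- The valuation at the point at infinity on the function field. -/
def inftyValuation (K : Type*) [Field K] (b : ℤ) : Valuation (FunField K b) ℤᵐ⁰ :=
  (inftyIntValuation K b).extendToLocalization nonZeroDivisors_le_primeCompl (FunField K b)

lemma inftyValuation_algebraMap (r : CoordRing K b) :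
    inftyValuation K b (algebraMap _ (FunField K b) r) = inftyIntValuation K b r :=
  Valuation.extendToLocalization_apply_map_apply _ _ _ _

variable [CharP K 5]

/-- The normalized discrete valuation of the function field at a point of the curve. -/
def Point.valuation : Point K b → Valuation (FunField K b) ℤᵐ⁰
  | .infinity => inftyValuation K b
  | .affine x y h => (pointIdeal x y h).valuation (FunField K b)

/-- The order of vanishing at `P` of a nonzero rational function. -/
def ord (P : Point K b) (h : FunField K b) : ℤ := -WithZero.log (P.valuation h)

lemma ord_one (P : Point K b) : ord P (1 : FunField K b) = 0 := by simp [ord]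

lemma ord_mul (P : Point K b) {g h : FunField K b} (hg : g ≠ 0) (hh : h ≠ 0) :
    ord P (g * h) = ord P g + ord P h := by
  rw [ord, ord, ord, map_mul, log_mul ((Valuation.ne_zero_iff _).2 hg)
    ((Valuation.ne_zero_iff _).2 hh)]
  ring

end Valuations

section Jacobian

variable (K : Type*) [Field K] [CharP K 5] (b : ℤ)

/-- Divisors on the curve over the algebraically closed field `K`. -/
abbrev Divisor : Type _ := Point K b →₀ ℤ

/-- The degree of a divisor: the sum of its coefficients. -/
def divDegree : Divisor K b →+ ℤ := Finsupp.liftAddHom fun _ => AddMonoidHom.id ℤ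

/-- The divisors of degree zero. -/
def degZero : AddSubgroup (Divisor K b) := (divDegree K b).ker

/-- The principal divisors: the divisors `∑ P, ord P h • P` of nonzero rational functions `h`. -/
def principal : AddSubgroup (Divisor K b) where
  carrier := {D | ∃ h : FunField K b, h ≠ 0 ∧ ∀ P, D P = ord P h}
  zero_mem' := ⟨1, one_ne_zero, fun P => by simp [ord_one]⟩
  add_mem' := by
    rintro D E ⟨g, hg, hD⟩ ⟨h, hh, hE⟩
    exact ⟨g * h, mul_ne_zero hg hh, fun P => by rw [Finsupp.add_apply, hD, hE, ord_mul P hg hh]⟩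
  neg_mem' := by
    rintro D ⟨g, hg, hD⟩
    refine ⟨g⁻¹, inv_ne_zero hg, fun P => ?_⟩
    have := ord_mul P hg (inv_ne_zero hg)
    rw [mul_inv_cancel₀ hg, ord_one] at this
    rw [Finsupp.neg_apply, hD]; omega

/-- The group of `K`-points of the Jacobian, for `K` algebraically closed: divisors of degree
zero modulo principal divisors. -/
abbrev Jac : Type _ := degZero K b ⧸ (principal K b).addSubgroupOf (degZero K b)

variable {K b}

/-- The push-forward of divisors of degree zero along a map on points. -/
def pushDegZero (g : Point K b → Point K b) : degZero K b →+ degZero K b :=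
  ((Finsupp.mapDomain.addMonoidHom g).comp (degZero K b).subtype).codRestrict (degZero K b) (by
    rintro ⟨D, hD⟩
    have h : (divDegree K b).comp (Finsupp.mapDomain.addMonoidHom g) = divDegree K b := by
      ext P; simp [divDegree]
    exact (DFunLike.congr_fun h D).trans hD)

/-- The endomorphism of the Jacobian induced by a map on points that preserves principality
of divisors. -/
def Jac.map (g : Point K b → Point K b)
    (hg : ∀ D ∈ principal K b, Finsupp.mapDomain g D ∈ principal K b) : Jac K b →+ Jac K b :=
  QuotientAddGroup.map _ _ (pushDegZero g) (fun D hD => hg D hD)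

end Jacobian


section Transport

variable {K : Type*} [Field K] {b : ℤ}

/-- The ring automorphism `u + v y ↦ τ u + c (τ v) y` of the coordinate ring. -/
def twist (τ : K[X] ≃+* K[X]) (c : K) (hc : c ≠ 0)
    (hτ : τ (quintic K b) = C c ^ 2 * quintic K b) : CoordRing K b ≃+* CoordRing K b where
  toFun r := ⟨τ r.re, C c * τ r.im⟩
  invFun r := ⟨τ.symm r.re, τ.symm (C c⁻¹ * r.im)⟩
  left_inv r := by
    refine QuadraticAlgebra.ext (by simp) ?_
    simp only [← mul_assoc, ← C_mul, inv_mul_cancel₀ hc]; simp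
  right_inv r := by
    refine QuadraticAlgebra.ext (by simp) ?_
    simp only [RingEquiv.apply_symm_apply, ← mul_assoc, ← C_mul, mul_inv_cancel₀ hc]; simp
  map_add' r s := QuadraticAlgebra.ext (by simp) (by simp; ring)
  map_mul' r s := QuadraticAlgebra.ext (by simp [hτ]; ring) (by simp; ring)

lemma norm_twist {τ : K[X] ≃+* K[X]} {c : K} (hc : c ≠ 0)
    (hτ : τ (quintic K b) = C c ^ 2 * quintic K b) (r : CoordRing K b) :
    QuadraticAlgebra.norm (twist τ c hc hτ r) = τ (QuadraticAlgebra.norm r) := by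
  rw [norm_eq, norm_eq, map_sub, map_mul, map_pow, map_pow, hτ]
  simp only [twist, RingEquiv.coe_mk, Equiv.coe_fn_mk]
  ring

variable [CharP K 5]

lemma intValuation_transport {v w : IsDedekindDomain.HeightOneSpectrum (CoordRing K b)}
    (θ : CoordRing K b ≃+* CoordRing K b) (h : ∀ r, θ r ∈ w.asIdeal ↔ r ∈ v.asIdeal)
    (r : CoordRing K b) : w.intValuation (θ r) = v.intValuation r := by
  have hmap : w.asIdeal = Ideal.map θ v.asIdeal := by
    ext s
    obtain ⟨s, rfl⟩ := θ.surjective s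
    rw [h, Ideal.mem_map_of_equiv]
    exact ⟨fun hs => ⟨s, hs, rfl⟩, fun ⟨t, ht, hts⟩ => θ.injective hts ▸ ht⟩
  have hpow (n : ℕ) : w.intValuation (θ r) ≤ exp (-(n : ℤ)) ↔ v.intValuation r ≤ exp (-(n : ℤ)) := by
    rw [w.intValuation_le_pow_iff_mem, v.intValuation_le_pow_iff_mem, hmap, ← Ideal.map_pow,
      Ideal.mem_map_of_equiv]
    exact ⟨fun ⟨t, ht, hts⟩ => θ.injective hts ▸ ht, fun hs => ⟨r, hs, rfl⟩⟩
  by_cases hr : r = 0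
  · simp [hr]
  have hr' : θ r ≠ 0 := by simpa using hr
  apply le_antisymm
  · rw [v.intValuation_if_neg hr, hpow, v.intValuation_if_neg hr]
  · rw [w.intValuation_if_neg hr', ← hpow, w.intValuation_if_neg hr']

/-- A bijection on points that is induced by an automorphism of the coordinate ring preserves
principal divisors. -/
lemma mapDomain_mem_principal {g : Point K b → Point K b} (hg : Function.Bijective g)
    (θ : CoordRing K b ≃+* CoordRing K b) (hinf : g .infinity = .infinity)
    (hdeg : ∀ r, (QuadraticAlgebra.norm (θ r)).natDegree = (QuadraticAlgebra.norm r).natDegree)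
    (haff : ∀ x y h, ∃ x' y' h', g (.affine x y h) = .affine x' y' h' ∧
      ∀ r, evalAt x' y' h' (θ r) = 0 ↔ evalAt x y h r = 0)
    (D : Divisor K b) (hD : D ∈ principal K b) : Finsupp.mapDomain g D ∈ principal K b := by
  obtain ⟨f, hf, hD⟩ := hD
  let Θ : FunField K b ≃+* FunField K b := IsFractionRing.ringEquivOfRingEquiv θ
  have hΘ (r : CoordRing K b) : Θ (algebraMap _ _ r) = algebraMap _ _ (θ r) :=
    IsFractionRing.ringEquivOfRingEquiv_algebraMap θ r
  have key (P : Point K b) (f : FunField K b) : (g P).valuation (Θ f) = P.valuation f := by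
    have hint (r : CoordRing K b) : (g P).valuation (Θ (algebraMap _ _ r)) =
        P.valuation (algebraMap _ _ r) := by
      rw [hΘ]
      cases P with
      | infinity =>
        rw [hinf]
        simp only [Point.valuation, inftyValuation_algebraMap]
        by_cases hr : r = 0
        · simp [hr]
        have hr' : θ r ≠ 0 := by simpa using hr
        rw [inftyIntValuation_of_ne_zero hr, inftyIntValuation_of_ne_zero hr', hdeg]
      | affine x y h =>
        obtain ⟨x', y', h', e, he⟩ := haff x y h
        rw [e]
        simp only [Point.valuation,
          IsDedekindDomain.HeightOneSpectrum.valuation_of_algebraMap]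
        exact intValuation_transport (v := pointIdeal x y h) (w := pointIdeal x' y' h') θ he r
    obtain ⟨r, s, hs, rfl⟩ := IsFractionRing.div_surjective (A := CoordRing K b) f
    rw [map_div₀, map_div₀, map_div₀, hint, hint]
  refine ⟨Θ f, by simpa using hf, fun Q => ?_⟩
  obtain ⟨P, rfl⟩ := hg.2 Q
  rw [Finsupp.mapDomain_apply hg.1, hD, ord, ord, key]

end Transport

section Maps

variable {K : Type*} [Field K] [CharP K 5] {b : ℤ}

lemma five_eq_zero : (5 : K) = 0 := by exact_mod_cast CharP.cast_eq_zero K 5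

lemma psi_equation {ρ : K} (hρ : ρ ^ 5 - ρ + 2 * (b : K) = 0) {x y : K}
    (h : y ^ 2 = x ^ 5 - x + (b : K)) :
    (2 * y) ^ 2 = (ρ - x) ^ 5 - (ρ - x) + (b : K) := by
  linear_combination 4 * h - hρ +
    (x ^ 5 - x + b + ρ ^ 4 * x - 2 * ρ ^ 3 * x ^ 2 + 2 * ρ ^ 2 * x ^ 3 - ρ * x ^ 4) *
      five_eq_zero (K := K)

/-- The map `(x, y) ↦ (ρ - x, 2 y)` on points. -/
def psiPoint (ρ : K) (hρ : ρ ^ 5 - ρ + 2 * (b : K) = 0) : Point K b → Point K b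
  | .infinity => .infinity
  | .affine x y h => .affine (ρ - x) (2 * y) (psi_equation hρ h)

lemma psiPoint_bijective (ρ : K) (hρ : ρ ^ 5 - ρ + 2 * (b : K) = 0) :
    Function.Bijective (psiPoint ρ hρ) := by
  have h4 (P : Point K b) :
      psiPoint ρ hρ (psiPoint ρ hρ (psiPoint ρ hρ (psiPoint ρ hρ P))) = P := by
    cases P with
    | infinity => rfl
    | affine x y h =>
      simp only [psiPoint, Point.affine.injEq]
      exact ⟨by ring, by linear_combination 3 * y * five_eq_zero (K := K)⟩
  exact ⟨fun P Q h => by rw [← h4 P, h, h4], fun P => ⟨_, h4 P⟩⟩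

lemma psiPoint_principal (ρ : K) (hρ : ρ ^ 5 - ρ + 2 * (b : K) = 0) (D : Divisor K b)
    (hD : D ∈ principal K b) : Finsupp.mapDomain (psiPoint ρ hρ) D ∈ principal K b := by
  have h5 := five_eq_zero (K := K)
  have hcomp : (C ρ - X : K[X]).comp (C ρ - X) = X := by simp
  let τ : K[X] ≃+* K[X] := (algEquivOfCompEqX (C ρ - X : K[X]) (C ρ - X) hcomp hcomp).toRingEquiv
  have hτ (p : K[X]) : τ p = p.comp (C ρ - X) := by
    rfl
  have h3 : (3 : K) ≠ 0 := by
    intro h; exact two_ne_zero_of_char (K := K) (by linear_combination h5 - h)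
  have hq : τ (quintic K b) = C 3 ^ 2 * quintic K b := by
    have h5' : (5 : K[X]) = 0 := by
      have := congrArg C h5
      rwa [map_zero] at this
    have hρ' : (C ρ : K[X]) ^ 5 - C ρ + 2 * C (b : K) = 0 := by
      have := congrArg C hρ
      rw [map_add, map_sub, map_pow, map_mul, map_zero] at this
      exact this
    rw [hτ, show (C 3 : K[X]) = 3 from rfl]
    simp only [quintic, add_comp, sub_comp, pow_comp, X_comp, C_comp]
    linear_combination hρ' + (C ρ * X ^ 4 - 2 * C ρ ^ 2 * X ^ 3 + 2 * C ρ ^ 3 * X ^ 2 -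
      C ρ ^ 4 * X + 2 * X - 2 * X ^ 5 - 2 * C (b : K)) * h5'
  refine mapDomain_mem_principal (psiPoint_bijective ρ hρ) (twist τ 3 h3 hq) rfl ?_ ?_ D hD
  · intro r
    rw [norm_twist, hτ, natDegree_comp]
    have : (C ρ - X : K[X]).natDegree = 1 := by
      rw [natDegree_sub, natDegree_X_sub_C]
    rw [this, mul_one]
  · intro x y h
    refine ⟨_, _, _, rfl, fun r => ?_⟩
    have : evalAt (ρ - x) (2 * y) (psi_equation hρ h) (twist τ 3 h3 hq r) = evalAt x y h r := by
      rw [evalAt_apply, evalAt_apply]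
      simp only [twist, RingEquiv.coe_mk, Equiv.coe_fn_mk, hτ, eval_mul, eval_comp, eval_sub,
        eval_C, eval_X, sub_sub_cancel]
      linear_combination (r.im.eval x * y) * h5
    rw [this]

/-- The endomorphism `ψ` of the Jacobian induced by `(x, y) ↦ (ρ - x, 2 y)`. -/
def psi (ρ : K) (hρ : ρ ^ 5 - ρ + 2 * (b : K) = 0) : Jac K b →+ Jac K b :=
  Jac.map (psiPoint ρ hρ) (psiPoint_principal ρ hρ)

lemma frob_expand (m : ℕ) (x : K) :
    (x ^ 5 - x + (b : K)) ^ 5 ^ m = (x ^ 5 ^ m) ^ 5 - x ^ 5 ^ m + (b : K) := by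
  have : Fact (Nat.Prime 5) := ⟨by norm_num⟩
  rw [← iterateFrobenius_def, map_add, map_sub, map_pow, map_intCast, iterateFrobenius_def]

lemma frob_equation (m : ℕ) {x y : K} (h : y ^ 2 = x ^ 5 - x + (b : K)) :
    (y ^ 5 ^ m) ^ 2 = (x ^ 5 ^ m) ^ 5 - x ^ 5 ^ m + (b : K) := by
  rw [← frob_expand, ← h]; ring

/-- The `5 ^ m`-power Frobenius map on points. -/
def frobPoint (m : ℕ) : Point K b → Point K b
  | .infinity => .infinity
  | .affine x y h => .affine (x ^ 5 ^ m) (y ^ 5 ^ m) (frob_equation m h)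

variable [IsAlgClosed K]

lemma frobPoint_bijective (m : ℕ) : Function.Bijective (frobPoint (K := K) (b := b) m) := by
  have : Fact (Nat.Prime 5) := ⟨by norm_num⟩
  have hinj : Function.Injective (fun x : K => x ^ 5 ^ m) := (iterateFrobenius K 5 m).injective
  constructor
  · intro P Q h
    cases P <;> cases Q
    · rfl
    · simp [frobPoint] at h
    · simp [frobPoint] at h
    · simp only [frobPoint, Point.affine.injEq] at h
      simp only [Point.affine.injEq]
      exact ⟨hinj h.1, hinj h.2⟩
  · intro P
    cases P with
    | infinity => exact ⟨.infinity, rfl⟩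
    | affine x y h =>
      have h5 : 0 < 5 ^ m := by positivity
      obtain ⟨x, rfl⟩ := IsAlgClosed.exists_pow_nat_eq x h5
      obtain ⟨y, rfl⟩ := IsAlgClosed.exists_pow_nat_eq y h5
      refine ⟨.affine x y (hinj ?_), rfl⟩
      change (y ^ 2) ^ 5 ^ m = (x ^ 5 - x + (b : K)) ^ 5 ^ m
      rw [frob_expand, ← h]; ring

lemma frobPoint_principal (m : ℕ) (D : Divisor K b) (hD : D ∈ principal K b) :
    Finsupp.mapDomain (frobPoint m) D ∈ principal K b := by
  have : Fact (Nat.Prime 5) := ⟨by norm_num⟩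
  let φ : K ≃+* K := iterateFrobeniusEquiv K 5 m
  have hφ (x : K) : φ x = x ^ 5 ^ m := rfl
  let τ : K[X] ≃+* K[X] := mapEquiv φ
  have hτ (p : K[X]) : τ p = p.map (φ : K →+* K) := rfl
  have hq : τ (quintic K b) = C 1 ^ 2 * quintic K b := by
    rw [hτ]; simp [quintic]
  refine mapDomain_mem_principal (frobPoint_bijective m) (twist τ 1 one_ne_zero hq) rfl ?_ ?_ D hD
  · intro r
    rw [norm_twist, hτ, natDegree_map]
  · intro x y h
    refine ⟨_, _, _, rfl, fun r => ?_⟩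
    have : evalAt (x ^ 5 ^ m) (y ^ 5 ^ m) (frob_equation m h) (twist τ 1 one_ne_zero hq r) =
        φ (evalAt x y h r) := by
      rw [evalAt_apply, evalAt_apply, map_add, map_mul, ← hφ, ← hφ]
      simp only [twist, RingEquiv.coe_mk, Equiv.coe_fn_mk, hτ, eval_mul, eval_C, one_mul]
      have e (p : K[X]) : (p.map (φ : K →+* K)).eval (φ x) = φ (p.eval x) :=
        eval_map_apply (φ : K →+* K) x
      rw [e, e]
    rw [this, map_eq_zero_iff _ φ.injective]

/-- The `5 ^ m`-power Frobenius endomorphism of the Jacobian. -/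
def frob (K : Type*) [Field K] [CharP K 5] [IsAlgClosed K] (b : ℤ) (m : ℕ) :
    Jac K b →+ Jac K b :=
  Jac.map (frobPoint m) (frobPoint_principal m)

lemma frob_comp (m n : ℕ) (D : Jac K b) : frob K b (m + n) D = frob K b m (frob K b n D) := by
  induction D using QuotientAddGroup.induction_on with
  | H D =>
    change (QuotientAddGroup.mk _ : Jac K b) = QuotientAddGroup.mk _
    congr 1
    apply Subtype.ext
    change Finsupp.mapDomain (frobPoint (m + n)) D.1 =
      Finsupp.mapDomain (frobPoint m) (Finsupp.mapDomain (frobPoint n) D.1)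
    rw [← Finsupp.mapDomain_comp]
    congr 1
    funext P
    cases P with
    | infinity => rfl
    | affine x y h =>
      simp only [frobPoint, Function.comp, Point.affine.injEq]
      exact ⟨by rw [← pow_mul, ← pow_add, add_comm], by rw [← pow_mul, ← pow_add, add_comm]⟩

lemma frob_zero (D : Jac K b) : frob K b 0 D = D := by
  induction D using QuotientAddGroup.induction_on with
  | H D =>
    change (QuotientAddGroup.mk _ : Jac K b) = QuotientAddGroup.mk _
    congr 1
    apply Subtype.ext
    change Finsupp.mapDomain (frobPoint 0) D.1 = D.1
    convert Finsupp.mapDomain_id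
    funext P
    cases P <;> simp [frobPoint]

lemma frob_iterate (m i : ℕ) (D : Jac K b) : (frob K b m)^[i] D = frob K b (m * i) D := by
  induction i with
  | zero => simp [frob_zero]
  | succ i ih => rw [Function.iterate_succ_apply', ih, ← frob_comp, Nat.mul_succ, add_comm]

end Maps

section Trace

variable (K : Type*) [Field K] [CharP K 5] [IsAlgClosed K] (b : ℤ)

/-- The group of `𝔽_{5 ^ m}`-rational points of the Jacobian (for `m > 0`): the divisor classes
over the algebraically closed field `K` that are fixed by the `5 ^ m`-power Frobenius. -/
def rationalPoints (m : ℕ) : AddSubgroup (Jac K b) where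
  carrier := {D | frob K b m D = D}
  zero_mem' := map_zero _
  add_mem' {D E} hD hE := by
    rw [Set.mem_ofPred_eq] at *
    rw [map_add, hD, hE]
  neg_mem' {D} hD := by
    rw [Set.mem_ofPred_eq] at *
    rw [map_neg, hD]

/-- The trace `D ↦ ∑_{i < n} π ^ i D` from the `𝔽_{q ^ n}`-points of the Jacobian to the
`𝔽_q`-points, where `q = 5 ^ m` and `π` is the `q`-power Frobenius. -/
def trace (m n : ℕ) : rationalPoints K b (m * n) →+ rationalPoints K b m where
  toFun D := ⟨∑ i ∈ Finset.range n, (frob K b m)^[i] D.1, by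
    change frob K b m _ = _
    rw [map_sum]
    simp only [← Function.iterate_succ_apply']
    have h := (Finset.sum_range_succ' (fun i => (frob K b m)^[i] D.1) n).symm.trans
      (Finset.sum_range_succ (fun i => (frob K b m)^[i] D.1) n)
    have hD : (frob K b m)^[n] D.1 = D.1 := (frob_iterate m n D.1).trans D.2
    rw [hD] at h
    exact add_right_cancel h⟩
  map_zero' := by
    apply Subtype.ext
    simp [iterate_map_zero]
  map_add' D E := by
    apply Subtype.ext
    simp [iterate_map_add, Finset.sum_add_distrib]

/-- The trace-zero subgroup of the group of `𝔽_{q ^ n}`-points of the Jacobian, where `q = 5 ^ m`: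
the kernel of the trace to the `𝔽_q`-points. -/
def traceZero (m n : ℕ) : AddSubgroup (rationalPoints K b (m * n)) := (trace K b m n).ker

end Trace

end QuinticCurve

end

/-! Write `ψ_ρ` for the endomorphism attached to a root `ρ` of `t ^ 5 - t + 2 b`. The roots form a
coset of `𝔽_5`, and two facts about the five maps `ψ_(ρ + j)` give the result.

Frobenius permutes them. Since `ρ ^ 5 = ρ - 2 b`, the `5 ^ m`-power map sends `ρ` to `ρ - 2 b m`
(`root_pow`), so `π ψ_ρ = ψ_(ρ - 2bm) π` (`frob_psi`). For rational `D` this gives `π ^ i (ψ_ρ D) =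
ψ_(ρ - 2bmi) D`. Five steps shift `ρ` by a multiple of `5`, hence rationality over `𝔽_(q ^ 5)`; as
`5` divides neither `m` nor `2 b`, the first five steps visit every root once.

They add up to zero (`sum_psi_translate`). The images of one affine point `(x, y)` are the five
points on the horizontal line of height `2 y`, and the function "coordinate minus `2 y`" has these
as simple zeros and a pole of order `5` at infinity (`sum_translate_sub_mem_principal`). A divisor
of degree zero is thus sent by the sum of the `ψ_(ρ + j)` to a principal divisor. -/

noncomputable section

open Polynomial WithZero

namespace QuinticCurve

/-! ### The divisor of a horizontal line -/

section LineDivisor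

variable {K : Type*} [Field K] {b : ℤ}

/-- The derivative at the affine point `(x, y)` along the curve with respect to the coordinate
`y`, for a curve with `dx / dy = -2 y`. -/
def derivAt (x y : K) : CoordRing K b →+ K where
  toFun r := -(2 * y) * (r.re.derivative.eval x + r.im.derivative.eval x * y) + r.im.eval x
  map_zero' := by simp
  map_add' r s := by simp; ring

lemma derivAt_apply (x y : K) (r : CoordRing K b) : derivAt x y r =
    -(2 * y) * (r.re.derivative.eval x + r.im.derivative.eval x * y) + r.im.eval x := rfl

/-- The function `y - c`. -/
def ySub (b : ℤ) (c : K) : CoordRing K b := ⟨-C c, 1⟩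

lemma ySub_ne_zero (c : K) : ySub b c ≠ 0 := fun h =>
  one_ne_zero (congrArg QuadraticAlgebra.im h)

lemma natDegree_norm_ySub (c : K) : (QuadraticAlgebra.norm (ySub b c)).natDegree = 5 := by
  have h : (QuadraticAlgebra.norm (ySub b c)).degree = 5 := by
    rw [degree_norm]
    simp only [ySub, one_pow, mul_one, degree_quintic, neg_sq, ← C_pow]
    exact max_eq_right (degree_C_le.trans (by norm_num))
  exact natDegree_eq_of_degree_eq_some h

variable [CharP K 5]

lemma derivative_quintic : derivative (quintic K b) = -1 := by
  have h5 : ((5 : ℕ) : K) = 0 := CharP.cast_eq_zero K 5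
  unfold quintic
  simp only [derivative_add, derivative_sub, derivative_X_pow, derivative_X, derivative_C, h5]
  simp

/-- Leibniz rule. In characteristic `5` the quintic has derivative `-1`, so `2 y dy = -dx` on the
curve: the choice `dx / dy = -2 y` respects the defining relation, and `y` is a local coordinate at
every affine point. -/
lemma derivAt_mul {x y : K} (h : y ^ 2 = x ^ 5 - x + (b : K)) (r s : CoordRing K b) :
    derivAt x y (r * s) = evalAt x y h r * derivAt x y s + evalAt x y h s * derivAt x y r := by
  have hq : (quintic K b).eval x = y ^ 2 := by rw [h]; simp [quintic]
  simp only [derivAt_apply, evalAt_apply, QuadraticAlgebra.re_mul, QuadraticAlgebra.im_mul,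
    derivative_add, derivative_mul, derivative_quintic, eval_add, eval_mul, eval_neg, eval_one, hq,
    zero_mul, derivative_zero, eval_zero]
  ring

/-- Used in contrapositive form: a nonzero derivative bounds the order of vanishing by `1`. -/
lemma derivAt_eq_zero_of_mem_sq {x y : K} (h : y ^ 2 = x ^ 5 - x + (b : K)) {r : CoordRing K b}
    (hr : r ∈ (pointIdeal x y h).asIdeal ^ 2) : derivAt x y r = 0 := by
  rw [sq] at hr
  refine Submodule.mul_induction_on hr (fun p hp q hq => ?_) fun p q hp hq => ?_
  · have hp' : evalAt x y h p = 0 := hp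
    have hq' : evalAt x y h q = 0 := hq
    rw [derivAt_mul h, hp', hq']; simp
  · rw [map_add, hp, hq, add_zero]

lemma ord_infinity_ySub (c : K) :
    ord (.infinity : Point K b) (algebraMap _ (FunField K b) (ySub b c)) = -5 := by
  rw [ord, Point.valuation, inftyValuation_algebraMap,
    inftyIntValuation_of_ne_zero (ySub_ne_zero c), natDegree_norm_ySub, log_exp]
  rfl

-- Every zero is simple because the derivative of `y - c` with respect to `y` is `1`, even where `y
-- = 0`.
open scoped Classical in
lemma ord_affine_ySub {x y : K} (h : y ^ 2 = x ^ 5 - x + (b : K)) (c : K) :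
    ord (.affine x y h) (algebraMap _ (FunField K b) (ySub b c)) = if y = c then 1 else 0 := by
  have hev : evalAt x y h (ySub b c) = y - c := by
    rw [evalAt_apply]; simp [ySub]; ring
  have hpow (n : ℕ) := (pointIdeal x y h).intValuation_le_pow_iff_mem (ySub b c) n
  -- Membership in the first and second powers of the maximal ideal decides whether the order is at
  -- least `1` and at least `2`; this determines it.
  rw [ord, Point.valuation, IsDedekindDomain.HeightOneSpectrum.valuation_of_algebraMap]
  have h1 := hpow 1
  have h2 := hpow 2
  rw [IsDedekindDomain.HeightOneSpectrum.intValuation_if_neg _ (ySub_ne_zero c)] at h1 h2 ⊢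
  rw [exp_le_exp] at h1 h2
  rw [log_exp]
  rw [pow_one] at h1
  have hmem : ySub b c ∈ (pointIdeal x y h).asIdeal ↔ y = c := by
    rw [← sub_eq_zero, ← hev]; rfl
  rw [hmem] at h1
  split_ifs with hc
  · have h3 : ySub b c ∉ (pointIdeal x y h).asIdeal ^ 2 := fun hs => by
      have := derivAt_eq_zero_of_mem_sq h hs
      simp [derivAt_apply, ySub] at this
    have h4 := h1.2 hc
    have h5 := h2.not.2 h3
    push_cast at h4 h5
    omega
  · have h4 := h1.not.2 hc
    push_cast at h4
    omega

/-- The roots of `t ^ 5 - t` are the elements of `𝔽_5`, and the multiples of a nonzero `k` run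
through all of them. -/
lemma pow_five_sub_self {k : ℤ} (hk : (k : K) ≠ 0) (t : K) :
    t ^ 5 - t = ∏ i ∈ Finset.range 5, (t - k * (i : K)) := by
  have : Fact (Nat.Prime 5) := ⟨by norm_num⟩
  have h5 := five_eq_zero (K := K)
  have hk5 : (k : K) ^ 5 = k := by rw [← frobenius_def, map_intCast]
  have hk4 : (k : K) ^ 4 = 1 := mul_left_cancel₀ hk (by linear_combination hk5)
  simp only [Finset.prod_range_succ, Finset.prod_range_zero]
  push_cast
  -- The product expands to `t^5 - 10 k t^4 + 35 k^2 t^3 - 50 k^3 t^2 + 24 k^4 t`, where `k^4 = 1`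
  -- and `24 = -1`.
  linear_combination (2 * k * t ^ 4 - 7 * k ^ 2 * t ^ 3 + 10 * k ^ 3 * t ^ 2 - 5 * t) * h5 -
    24 * t * hk4

/-- The Artin–Schreier map `x ↦ x ^ 5 - x` is additive and kills `𝔽_5`. -/
lemma translate_equation {x y : K} (h : y ^ 2 = x ^ 5 - x + (b : K)) (n : ℤ) :
    y ^ 2 = (x + n) ^ 5 - (x + n) + (b : K) := by
  have : Fact (Nat.Prime 5) := ⟨by norm_num⟩
  rw [h, add_pow_char, ← frobenius_def (p := 5) (n : K), map_intCast]; ring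

/-- The five points with the same `y`-coordinate sum to `5 ∞` up to a principal divisor. -/
lemma sum_translate_sub_mem_principal {x y : K} (h : y ^ 2 = x ^ 5 - x + (b : K)) {k : ℤ}
    (hk : (k : K) ≠ 0) :
    ∑ i ∈ Finset.range 5, (Finsupp.single (Point.affine (x + (k * (i : ℤ) : ℤ)) y
      (translate_equation h _)) (1 : ℤ) - Finsupp.single Point.infinity 1) ∈ principal K b := by
  classical
  refine ⟨algebraMap _ (FunField K b) (ySub b y),
    (map_ne_zero_iff _ (IsFractionRing.injective _ _)).2 (ySub_ne_zero y), fun P => ?_⟩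
  rw [Finsupp.finsetSum_apply]
  cases P with
  | infinity =>
    rw [ord_infinity_ySub]
    simp
  | affine x' y' h' =>
    rw [ord_affine_ySub]
    simp only [Finsupp.sub_apply, Finsupp.single_apply, Point.affine.injEq, reduceCtorEq, if_false,
      sub_zero]
    split_ifs with hy
    · subst hy
      -- Two points of equal height have abscissas that differ by an element of `𝔽_5`, so exactly
      -- one of the five summands is supported at this point.
      have ht : (x' - x) ^ 5 - (x' - x) = 0 := by
        have : Fact (Nat.Prime 5) := ⟨by norm_num⟩
        rw [sub_pow_char]
        linear_combination h - h'
      rw [pow_five_sub_self hk, Finset.prod_eq_zero_iff] at ht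
      obtain ⟨i, hi, hti⟩ := ht
      rw [Finset.sum_eq_single_of_mem i hi]
      · rw [if_pos]
        refine ⟨?_, rfl⟩
        push_cast
        linear_combination -hti
      · intro j hj hji
        rw [if_neg]
        rintro ⟨hx, -⟩
        push_cast at hx
        have hij : (j : K) = i := mul_left_cancel₀ hk (by linear_combination hx + hti)
        rw [CharP.cast_eq_iff_mod_eq K 5] at hij
        rw [Finset.mem_range] at hi hj
        rw [Nat.mod_eq_of_lt hi, Nat.mod_eq_of_lt hj] at hij
        exact hji hij
    · exact Finset.sum_eq_zero fun i _ => if_neg fun hh => hy hh.2.symm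

end LineDivisor

/-! ### Frobenius and the sum over the five roots -/

section TraceZero

variable {K : Type*} [Field K] [CharP K 5] {b : ℤ}

lemma translate_root {ρ : K} (hρ : ρ ^ 5 - ρ + 2 * (b : K) = 0) (n : ℤ) :
    (ρ + n) ^ 5 - (ρ + n) + 2 * (b : K) = 0 := by
  have : Fact (Nat.Prime 5) := ⟨by norm_num⟩
  rw [add_pow_char, ← frobenius_def (p := 5) (n : K), map_intCast]
  linear_combination hρ

/-- Each fifth power adds `-2 b` and fixes the integer shift already accumulated. -/
lemma root_pow {ρ : K} (hρ : ρ ^ 5 - ρ + 2 * (b : K) = 0) (n : ℕ) :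
    ρ ^ 5 ^ n = ρ + (-2 * b * (n : ℤ) : ℤ) := by
  have : Fact (Nat.Prime 5) := ⟨by norm_num⟩
  induction n with
  | zero => simp
  | succ n ih =>
    rw [pow_succ, pow_mul, ih, add_pow_char, ← frobenius_def (p := 5) (Int.cast _ : K),
      map_intCast]
    push_cast
    linear_combination hρ

lemma psi_congr {ρ ρ' : K} (hρ : ρ ^ 5 - ρ + 2 * (b : K) = 0)
    (hρ' : ρ' ^ 5 - ρ' + 2 * (b : K) = 0) (e : ρ = ρ') : psi ρ hρ = psi ρ' hρ' := by
  subst e; rfl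

/-- The endomorphisms `ψ` attached to the five roots `ρ` add up to zero. -/
lemma sum_psi_translate {ρ : K} (hρ : ρ ^ 5 - ρ + 2 * (b : K) = 0) {k : ℤ} (hk : (k : K) ≠ 0)
    (D : Jac K b) :
    ∑ i ∈ Finset.range 5, psi (ρ + (k * (i : ℤ) : ℤ)) (translate_root hρ _) D = 0 := by
  let S : Divisor K b →+ Divisor K b := ∑ i ∈ Finset.range 5, (Finsupp.mapDomain.addMonoidHom
    (psiPoint (ρ + (k * (i : ℤ) : ℤ)) (translate_root hρ _)))
  -- Tracking the degree allows divisors of any degree, so that linearity reduces the claim to a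
  -- single point.
  have hS (E : Divisor K b) :
      S E - Finsupp.single .infinity (5 * divDegree K b E) ∈ principal K b := by
    induction E using Finsupp.induction_linear with
    | zero => simp
    | add E F hE hF =>
      convert add_mem hE hF using 1
      rw [map_add, map_add, mul_add, Finsupp.single_add]; abel
    | single P n =>
      have h1 : S (Finsupp.single P 1) - Finsupp.single .infinity 5 ∈ principal K b := by
        cases P with
        | infinity =>
          convert zero_mem (principal K b)
          simp only [S, AddMonoidHom.finsetSum_apply, Finsupp.mapDomain.addMonoidHom_apply,
            Finsupp.mapDomain_single, psiPoint]
          simp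
        | affine x y h =>
          -- The images of `(x, y)` are the translates of `(ρ - x, 2 y)` by multiples of `k`.
          convert sum_translate_sub_mem_principal (psi_equation hρ h) hk using 1
          rw [Finset.sum_sub_distrib]
          congr 1
          · simp only [S, AddMonoidHom.finsetSum_apply, Finsupp.mapDomain.addMonoidHom_apply,
              Finsupp.mapDomain_single, psiPoint]
            refine Finset.sum_congr rfl fun i _ => ?_
            congr 2
            ring
          · simp
      convert zsmul_mem h1 n using 1
      rw [zsmul_sub, ← map_zsmul]
      simp [divDegree, mul_comm]
  induction D using QuotientAddGroup.induction_on with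
  | H D =>
    change ∑ i ∈ Finset.range 5, QuotientAddGroup.mk' _ (pushDegZero
      (psiPoint (ρ + (k * (i : ℤ) : ℤ)) (translate_root hρ _)) D) = 0
    rw [← map_sum]
    refine (QuotientAddGroup.eq_zero_iff _).2 ?_
    rw [AddSubgroup.mem_addSubgroupOf]
    have h0 : divDegree K b D.1 = 0 := D.2
    have h1 := hS D.1
    rw [h0, mul_zero, Finsupp.single_zero, sub_zero] at h1
    convert h1 using 1
    rw [AddSubgroup.val_finsetSum, AddMonoidHom.finsetSum_apply]
    rfl

variable [IsAlgClosed K]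

/-- Already true on points: Frobenius is additive, fixes the coefficient `2`, and moves only the
parameter `ρ`. -/
lemma frob_psi {ρ : K} (hρ : ρ ^ 5 - ρ + 2 * (b : K) = 0) (n : ℕ) (D : Jac K b) :
    frob K b n (psi ρ hρ D) =
      psi (ρ + (-2 * b * (n : ℤ) : ℤ)) (translate_root hρ _) (frob K b n D) := by
  have : Fact (Nat.Prime 5) := ⟨by norm_num⟩
  induction D using QuotientAddGroup.induction_on with
  | H D =>
    change (QuotientAddGroup.mk _ : Jac K b) = QuotientAddGroup.mk _
    congr 1
    apply Subtype.ext
    change Finsupp.mapDomain (frobPoint n) (Finsupp.mapDomain (psiPoint ρ hρ) D.1) =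
      Finsupp.mapDomain (psiPoint _ (translate_root hρ _)) (Finsupp.mapDomain (frobPoint n) D.1)
    rw [← Finsupp.mapDomain_comp, ← Finsupp.mapDomain_comp]
    congr 1
    funext P
    cases P with
    | infinity => rfl
    | affine x y h =>
      simp only [frobPoint, psiPoint, Function.comp, Point.affine.injEq]
      refine ⟨by rw [sub_pow_char_pow, root_pow hρ], ?_⟩
      rw [mul_pow, ← iterateFrobenius_def (p := 5) (x := (2 : K)), map_ofNat]

end TraceZero

end QuinticCurve

end

theorem mainTheorem9 {K : Type*} [Field K] [CharP K 5] [IsAlgClosed K]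
    (m : ℕ) (hm : Nat.Coprime m 10) (b : ℤ) (hb : b = 1 ∨ b = -1)
    (ρ : K) (hρ : ρ ^ 5 - ρ + 2 * (b : K) = 0)
    (D : QuinticCurve.Jac K b) (hD : D ∈ QuinticCurve.rationalPoints K b m) :
    ∃ h : QuinticCurve.psi ρ hρ D ∈ QuinticCurve.rationalPoints K b (m * 5),
      (⟨QuinticCurve.psi ρ hρ D, h⟩ : QuinticCurve.rationalPoints K b (m * 5)) ∈
        QuinticCurve.traceZero K b m 5 := by
  have hfix (i : ℕ) : QuinticCurve.frob K b (m * i) D = D := by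
    rw [← QuinticCurve.frob_iterate]
    exact Function.iterate_fixed hD i
  have h5 := QuinticCurve.five_eq_zero (K := K)
  refine ⟨?_, ?_⟩
  · change QuinticCurve.frob K b (m * 5) _ = _
    rw [QuinticCurve.frob_psi, hfix]
    refine DFunLike.congr_fun (QuinticCurve.psi_congr _ _ ?_) D
    push_cast
    -- The total shift after `5 m` fifth powers is `-10 b m = 0`.
    linear_combination -2 * (b : K) * m * h5
  -- The shift produced by one application of `π`; being nonzero modulo `5`, it serves as the step
  -- `k` through the roots.
  · have hk : ((-2 * b * m : ℤ) : K) ≠ 0 := by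
      rw [Ne, CharP.intCast_eq_zero_iff K 5]
      have h5m : ¬ 5 ∣ m := fun h =>
        absurd (Nat.dvd_gcd h (by norm_num : 5 ∣ 10)) (by rw [hm.gcd_eq_one]; norm_num)
      rcases hb with rfl | rfl <;> push_cast <;> omega
    refine (AddMonoidHom.mem_ker).2 (Subtype.ext ?_)
    change ∑ i ∈ Finset.range 5, (QuinticCurve.frob K b m)^[i] (QuinticCurve.psi ρ hρ D) = 0
    rw [← QuinticCurve.sum_psi_translate hρ hk D]
    refine Finset.sum_congr rfl fun i _ => ?_
    rw [QuinticCurve.frob_iterate, QuinticCurve.frob_psi, hfix]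
    refine DFunLike.congr_fun (QuinticCurve.psi_congr _ _ ?_) D
    push_cast
    ring
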